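/- Consider the following frog model on $\mathbb{Z}$. Let $(X_j)_{j\ge 1}$ be independent $\{0,1,2,\dots\}$-valued random variables with $\mathbb{P}(X_j\ge 1)>0$ for every $j\ge 1$, and with $X_{j+1}$ stochastically dominating $X_j$ for every $j\ge 1$, that is, $\mathbb{P}(X_{j+1}\ge k)\ge \mathbb{P}(X_j\ge k)$ for all $k\ge 0$. Let $p_0,p_1,p_2,\dots$ be real numbers with $\tfrac12<p_j<1$ for all $j\ge 0$ and $p_{j+1}\le p_j$ for all $j\ge 1$. At time $0$ there is one active frog at the origin, there are $X_j$ sleeping frogs at each site $j\ge 1$, and there are no frogs at the negative sites. In each unit of time every active frog makes one step on $\mathbb{Z}$: a frog that started at the site $j\ge 0$ steps by $-1$ with probability $p_j$ and by $+1$ with probability $1-p_j$. All steps of all frogs are mutually independent and independent of $(X_j)_{j\ge 1}$. Whenever an active frog lands on a site with sleeping frogs, all of these become active and start moving from the next time step on. The model is called transient if almost surely only finitely many distinct frogs ever hit the origin. Let $f_j(s)=\sum_{k\ge 0}\mathbb{P}(X_j=k)\,s^k$ be the probability generating function of $X_j$. Then the model is transient if and only if $$\sum_{n=2}^{\infty}\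 \prod_{j=1}^{n-1} f_j\!\left(1-\left(\frac{1-p_j}{p_j}\right)^{n-j}\right)=\infty .$$ -/

import Mathlib

open MeasureTheory ProbabilityTheory

namespace FrogModel

/-! ### Deterministic dynamics, for a given environment

A frog is a pair `(j, i)`: the `i`-th frog (counted from `0`) that starts at the site `j ≥ 0`.
`x j` is the number of frogs that start at site `j`, so the frog `(j, i)` exists iff `i < x j`.
`ξ j i n` is the `n`-th step that the frog `(j, i)` makes after having been woken up.
No frog starts to the left of the origin, so starting sites are natural numbers, while positions
are integers. -/

/-- Position of the frog `(j, i)` when it has made `m` steps since it was woken up. -/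
def position (ξ : ℕ → ℕ → ℕ → ℤ) (j i m : ℕ) : ℤ :=
  (j : ℤ) + ∑ n ∈ Finset.range m, ξ j i n

open Classical in
/-- State of the system at time `t`. The value at `j` is `none` if the frogs that start at `j` are
still asleep at time `t`, and `some a` if they are awake and have made `a` steps by time `t`.
At time `0` only the origin is awake. In each unit of time every awake frog makes one step, and the
sleeping frogs at each site on which an awake frog lands are woken up. -/
noncomputable def state (x : ℕ → ℕ) (ξ : ℕ → ℕ → ℕ → ℤ) : ℕ → ℕ → Option ℕ
  | 0 => fun j => if j = 0 then some 0 else none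
  | t + 1 => fun j =>
    match state x ξ t j with
    | some a => some (a + 1)
    | none =>
      if ∃ k a i, state x ξ t k = some a ∧ i < x k ∧ position ξ k i (a + 1) = (j : ℤ)
      then some 0 else none

/-- The frog `(j, i)` exists and, at some time at which it is awake, sits at the origin. -/
def HitsOrigin (x : ℕ → ℕ) (ξ : ℕ → ℕ → ℕ → ℤ) (j i : ℕ) : Prop :=
  i < x j ∧ ∃ t a, state x ξ t j = some a ∧ position ξ j i a = 0

/-! ### The random model -/

/-- `Y'` dominates `Y` in the usual stochastic order. -/
def StochLE {Ω : Type*} [MeasurableSpace Ω] (P : Measure Ω) (Y Y' : Ω → ℕ) : Prop :=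
  ∀ k : ℕ, P {ω | k ≤ Y ω} ≤ P {ω | k ≤ Y' ω}

/-- Probability generating function `s ↦ ∑ₖ P(Y = k) sᵏ` of an `ℕ`-valued random variable. -/
noncomputable def pgf {Ω : Type*} [MeasurableSpace Ω] (P : Measure Ω) (Y : Ω → ℕ) (s : ℝ) : ℝ :=
  ∑' k : ℕ, P.real {ω | Y ω = k} * s ^ k

/-- The nonhomogeneous frog model on `ℤ`: `X j` is the number of frogs starting at site `j`
(with a single frog at the origin), `ξ j i n` is the `n`-th step of the frog `(j, i)`, and `p j` is
the probability with which frogs from site `j` step to the left. -/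
structure IsNonhomogeneous {Ω : Type*} [MeasurableSpace Ω] (P : Measure Ω) (p : ℕ → ℝ)
    (X : ℕ → Ω → ℕ) (ξ : ℕ → ℕ → ℕ → Ω → ℤ) : Prop where
  measurable_count : ∀ j, Measurable (X j)
  measurable_step : ∀ j i n, Measurable (ξ j i n)
  drift : ∀ j, 1 / 2 < p j ∧ p j < 1
  /-- No comparison of `p 0` with the other drifts is assumed. -/
  drift_decreasing : ∀ j, 1 ≤ j → p (j + 1) ≤ p j
  count_origin : ∀ ω, X 0 ω = 1
  count_nonzero : ∀ j, 1 ≤ j → 0 < P {ω | X j ω ≠ 0}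
  count_increasing : ∀ j, 1 ≤ j → StochLE P (X j) (X (j + 1))
  step_left : ∀ j i n, P {ω | ξ j i n ω = -1} = ENNReal.ofReal (p j)
  step_right : ∀ j i n, P {ω | ξ j i n ω = 1} = ENNReal.ofReal (1 - p j)
  indep_count : iIndepFun X P
  indep_step : iIndepFun (fun (m : ℕ × ℕ × ℕ) => ξ m.1 m.2.1 m.2.2) P
  indep_count_step : IndepFun (fun ω j => X j ω) (fun ω j i n => ξ j i n ω) P

/-- Transience: almost surely only finitely many frogs hit the origin. -/
def Transient {Ω : Type*} [MeasurableSpace Ω] (P : Measure Ω)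
    (X : ℕ → Ω → ℕ) (ξ : ℕ → ℕ → ℕ → Ω → ℤ) : Prop :=
  ∀ᵐ ω ∂P, {f : ℕ × ℕ |
    HitsOrigin (fun j => X j ω) (fun j i n => ξ j i n ω) f.1 f.2}.Finite

end FrogModel

/-! Attach to every site `j` its reach: the furthest distance to the right of `j` that one of its
frogs would attain once awake. Reaches of distinct sites are independent. The awake sites fill `[0,
n)`, where `n ≥ 1` is the first site not reached from its left, or everything if there is no such
`n`. In the first case finitely many frogs ever move. In the second every frog wakes up and,
drifting to `-∞`, passes the origin; infinitely many sites are occupied. So transience means that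
almost surely some site is not reached from its left (`transient_iff_ae_exists_noneReach`).

Gambler's ruin (`IsWalk.measure_reach`) and conditioning on the number of frogs turn the products in
the series into the probabilities `a n` that a site is not reached from the `n` sites `1, …, n` on
its left. It remains to prove a zero-one law, `ae_exists_noneReach_iff`.

If the `a n` are summable, then by Borel–Cantelli, with positive probability all sites beyond some
`N` are reached from positive sites. Independently, the frog from the origin covers the sites up to
`N + 1` with positive probability. Then no site is missed.

If they are not summable, stochastic monotonicity of the reaches gives the renewal-type bound `a n *
a l` for missing both of two sites `l` apart. The second moment of the number of missed sites is
thus at most twice its squared mean, and Kochen–Stone gives infinitely many missed sites with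
positive probability. Kolmogorov's law makes this probability one. The finitely many sites ignored
by the tail event, including the origin, have finite reach and do not affect far sites. -/

namespace FrogModel
open Filter Finset
open scoped ENNReal

variable {Ω : Type*} [MeasurableSpace Ω] {P : Measure Ω}

/-! ### Second moments and Kochen–Stone -/

/-- A second moment estimate: a sum of indicators whose second moment is at most `C` times its
squared mean exceeds half of its mean with probability at least `1 / (4 * C)`. -/
lemma half_mean_le_prob [IsProbabilityMeasure P] {A : ℕ → Set Ω} (hA : ∀ n, MeasurableSet (A n))
    {C : ℝ} (hC : 0 < C) {N : ℕ}
    (h2 : ∑ n ∈ range N, ∑ m ∈ range N, P.real (A n ∩ A m)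
      ≤ C * (∑ n ∈ range N, P.real (A n)) ^ 2)
    (hpos : 0 < ∑ n ∈ range N, P.real (A n)) :
    1 / (4 * C) ≤ P.real {ω | (∑ n ∈ range N, P.real (A n)) / 2
      ≤ ∑ n ∈ range N, (A n).indicator (fun _ => (1 : ℝ)) ω} := by
  set M := ∑ n ∈ range N, P.real (A n) with hM
  set S : Ω → ℝ := fun ω => ∑ n ∈ range N, (A n).indicator (fun _ => (1 : ℝ)) ω with hS
  have hSm : Measurable S :=
    Finset.measurable_sum _ fun n _ => measurable_const.indicator (hA n)
  set D : Set Ω := {ω | M / 2 ≤ S ω} with hD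
  have hDm : MeasurableSet D := measurableSet_le measurable_const hSm
  have hint : ∀ B : Set Ω, MeasurableSet B → Integrable (B.indicator fun _ => (1 : ℝ)) P :=
    fun B hB => (integrable_const _).indicator hB
  have hval : ∀ B : Set Ω, MeasurableSet B → ∫ ω, B.indicator (fun _ => (1 : ℝ)) ω ∂P = P.real B :=
    fun B hB => by rw [integral_indicator_const _ hB]; simp
  have hSint : Integrable S P := integrable_finsetSum _ fun n _ => hint _ (hA n)
  have hSval : ∫ ω, S ω ∂P = M := by
    simp only [hS]
    rw [integral_finsetSum _ fun n _ => hint _ (hA n)]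
    exact sum_congr rfl fun n _ => hval _ (hA n)
  have hSS : ∀ ω, S ω ^ 2 = ∑ n ∈ range N, ∑ m ∈ range N,
      (A n ∩ A m).indicator (fun _ => (1 : ℝ)) ω := by
    intro ω
    simp only [hS, sq, sum_mul_sum]
    refine sum_congr rfl fun n _ => sum_congr rfl fun m _ => ?_
    by_cases h1 : ω ∈ A n <;> by_cases h3 : ω ∈ A m <;> simp [h1, h3]
  have hSSint : Integrable (fun ω => S ω ^ 2) P := by
    simp only [hSS]
    exact integrable_finsetSum _ fun n _ => integrable_finsetSum _ fun m _ =>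
      hint _ ((hA n).inter (hA m))
  have hSSval : ∫ ω, S ω ^ 2 ∂P ≤ C * M ^ 2 := by
    simp only [hSS]
    rw [integral_finsetSum _ fun n _ => integrable_finsetSum _ fun m _ =>
      hint _ ((hA n).inter (hA m))]
    refine le_trans (le_of_eq (sum_congr rfl fun n _ => ?_)) h2
    rw [integral_finsetSum _ fun m _ => hint _ ((hA n).inter (hA m))]
    exact sum_congr rfl fun m _ => hval _ ((hA n).inter (hA m))
  -- On `D` this is AM–GM, `S ≤ S ^ 2 / (4 * C * M) + C * M`. The weight makes the quadratic term
  -- integrate to at most `M / 4`, which leaves `M / 4 ≤ C * M * P.real D`.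
  have key : ∀ ω, S ω ≤ M / 2 + (S ω ^ 2 / (4 * C * M)
      + C * M * D.indicator (fun _ => (1 : ℝ)) ω) := by
    intro ω
    by_cases hω : ω ∈ D
    · have h0 : 0 ≤ (S ω - 2 * (C * M)) ^ 2 / (4 * C * M) := by positivity
      have : (S ω - 2 * (C * M)) ^ 2 / (4 * C * M)
          = S ω ^ 2 / (4 * C * M) - S ω + C * M := by field_simp; ring
      simp only [hω, Set.indicator_of_mem, mul_one]
      linarith
    · have h0 : 0 ≤ S ω ^ 2 / (4 * C * M) := by positivity
      have : S ω < M / 2 := not_le.1 hω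
      simp only [hω, Set.indicator_of_notMem, not_false_eq_true, mul_zero]
      linarith
  have hmono := integral_mono hSint
    ((integrable_const (M / 2)).add ((hSSint.div_const (4 * C * M)).add
      ((hint D hDm).const_mul (C * M)))) key
  simp only [Pi.add_apply] at hmono
  rw [integral_add (integrable_const _) (by
      exact (hSSint.div_const (4 * C * M)).add ((hint D hDm).const_mul (C * M))),
    integral_add (hSSint.div_const (4 * C * M)) ((hint D hDm).const_mul (C * M)),
    integral_const, integral_div, integral_const_mul, hval D hDm, hSval] at hmono
  simp only [probReal_univ, smul_eq_mul, one_mul] at hmono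
  have h3 : (∫ ω, S ω ^ 2 ∂P) / (4 * C * M) ≤ M / 4 := by
    rw [div_le_iff₀ (by positivity)]
    linarith
  have h4 : M * (1 / 4) ≤ M * (C * P.real D) := by linarith
  have h5 := le_of_mul_le_mul_left h4 hpos
  rw [div_le_iff₀ (by positivity)]
  linarith

/-- A form of the Kochen–Stone lemma. -/
lemma measure_frequently_ne_zero [IsProbabilityMeasure P] {A : ℕ → Set Ω}
    (hA : ∀ n, MeasurableSet (A n)) {C : ℝ} (hC : 0 < C)
    (h2 : ∀ N, ∑ n ∈ range N, ∑ m ∈ range N, P.real (A n ∩ A m)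
      ≤ C * (∑ n ∈ range N, P.real (A n)) ^ 2)
    (hsum : Tendsto (fun N => ∑ n ∈ range N, P.real (A n)) atTop atTop) :
    P {ω | ∃ᶠ n in atTop, ω ∈ A n} ≠ 0 := by
  have hlow : ∀ K, ENNReal.ofReal (1 / (4 * C)) ≤ P (⋃ n ∈ Set.Ici K, A n) := by
    intro K
    -- If no `A n` with `n ≥ K` occurs, at most `K` indicators are nonzero; a mean above `2 * K`
    -- rules this out on the event of `half_mean_le_prob`.
    obtain ⟨N, hN⟩ := (hsum.eventually_gt_atTop (2 * (K : ℝ))).exists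
    have hpos : 0 < ∑ n ∈ range N, P.real (A n) := lt_of_le_of_lt (by positivity) hN
    have := half_mean_le_prob hA hC (h2 N) hpos
    rw [ENNReal.ofReal_le_iff_le_toReal (measure_ne_top _ _)]
    refine this.trans (measureReal_mono ?_ (measure_ne_top _ _))
    intro ω hω
    by_contra hcon
    simp only [Set.mem_iUnion, Set.mem_Ici, not_exists] at hcon
    simp only [Set.mem_ofPred_eq] at hω
    have : ∑ n ∈ range N, (A n).indicator (fun _ => (1 : ℝ)) ω ≤ K := by
      calc ∑ n ∈ range N, (A n).indicator (fun _ => (1 : ℝ)) ω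
          ≤ ∑ n ∈ range N, if n < K then (1 : ℝ) else 0 := by
            refine sum_le_sum fun n _ => ?_
            split_ifs with hn
            · exact Set.indicator_le_self' (fun _ _ => zero_le_one) ω
            · simp [hcon n (not_lt.1 hn)]
        _ = (((range N).filter (· < K)).card : ℝ) := by simp
        _ ≤ ((range K).card : ℝ) := by
            exact_mod_cast card_le_card fun n hn => by simp at hn ⊢; exact hn.2
        _ = K := by simp
    linarith
  have hset : {ω | ∃ᶠ n in atTop, ω ∈ A n} = ⋂ K, ⋃ n ∈ Set.Ici K, A n := by
    ext ω
    simp [frequently_atTop]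
  rw [hset]
  have hanti : Antitone fun K => ⋃ n ∈ Set.Ici K, A n := fun K L hKL =>
    Set.biUnion_subset_biUnion_left (Set.Ici_subset_Ici.2 hKL)
  have hlim := tendsto_measure_iInter_atTop (μ := P)
    (fun K => (MeasurableSet.biUnion (Set.to_countable (Set.Ici K))
      fun n _ => hA n).nullMeasurableSet) hanti ⟨0, measure_ne_top _ _⟩
  have := ge_of_tendsto' hlim hlow
  exact ne_of_gt (lt_of_lt_of_le (by rw [ENNReal.ofReal_pos]; positivity) this)

/-! ### Zero-one law for independent reaches -/

section Blocking

variable {m : ℕ → MeasurableSpace Ω} {B : ℕ → ℕ → Set Ω}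

/-- Given sets `B j k`, the event that none of the sites `j < n` reaches distance `n - j`. -/
def noneReach {Ω : Type*} (B : ℕ → ℕ → Set Ω) (n : ℕ) : Set Ω := ⋂ j ∈ range n, (B j (n - j))ᶜ

lemma mem_noneReach {Ω : Type*} {B : ℕ → ℕ → Set Ω} {n : ℕ} {ω : Ω} : ω ∈ noneReach B n ↔ ∀ j < n, ω ∉ B j (n - j) := by
  simp [noneReach]

lemma measurableSet_noneReach (hB : ∀ j k, MeasurableSet (B j k)) (n : ℕ) :
    MeasurableSet (noneReach B n) :=
  Finset.measurableSet_biInter _ fun _ _ => (hB _ _).compl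

lemma measure_noneReach (hind : iIndep m P) (hB : ∀ j k, MeasurableSet[m j] (B j k)) (n : ℕ) :
    P.real (noneReach B n) = ∏ j ∈ range n, P.real (B j (n - j))ᶜ := by
  have := hind.meas_biInter (S := range n) (s := fun j => (B j (n - j))ᶜ)
    fun j _ => (hB j (n - j)).compl
  simp only [measureReal_def]
  rw [noneReach, this, ENNReal.toReal_prod]

/-- Sites left of `n` need only miss `n`, and only sites from `n` on are asked to miss `n + l`.
These constraints are independent, and shifting the second group back by `n` can only increase its
probability. -/
lemma measure_noneReach_inter_le (hind : iIndep m P) (hB : ∀ j k, MeasurableSet[m j] (B j k))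
    (hmono : ∀ j k, 1 ≤ k → P.real (B (j + 1) k)ᶜ ≤ P.real (B j k)ᶜ) (n l : ℕ) :
    P.real (noneReach B n ∩ noneReach B (n + l))
      ≤ P.real (noneReach B n) * P.real (noneReach B l) := by
  have : IsProbabilityMeasure P := hind.isProbabilityMeasure
  have hshift : ∀ n j k, 1 ≤ k → P.real (B (n + j) k)ᶜ ≤ P.real (B j k)ᶜ := by
    intro n j k hk
    induction n with
    | zero => simp
    | succ n ih => exact le_trans (by rw [Nat.add_right_comm]; exact hmono _ _ hk) ih
  have h1 := hind.meas_biInter (S := range (n + l))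
    (s := fun j => if j < n then (B j (n - j))ᶜ else (B j (n + l - j))ᶜ)
    (by intro j _; split_ifs <;> exact (hB _ _).compl)
  calc P.real (noneReach B n ∩ noneReach B (n + l))
      ≤ P.real (⋂ j ∈ range (n + l), if j < n then (B j (n - j))ᶜ else (B j (n + l - j))ᶜ) := by
        refine measureReal_mono ?_ (measure_ne_top _ _)
        rintro ω ⟨h2, h3⟩
        rw [mem_noneReach] at h2 h3
        simp only [Set.mem_iInter, mem_range]
        intro j hj
        split_ifs with hjn
        · exact h2 j hjn
        · exact h3 j hj
    _ = ∏ j ∈ range (n + l),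
          P.real (if j < n then (B j (n - j))ᶜ else (B j (n + l - j))ᶜ) := by
        simp only [measureReal_def]
        rw [h1, ENNReal.toReal_prod]
    _ = (∏ j ∈ range n, P.real (B j (n - j))ᶜ) *
          ∏ j ∈ range l, P.real (B (n + j) (l - j))ᶜ := by
        rw [prod_range_add]
        congr 1
        · refine prod_congr rfl fun j hj => ?_
          rw [if_pos (mem_range.1 hj)]
        · refine prod_congr rfl fun j hj => ?_
          rw [if_neg (by omega), Nat.add_sub_add_left]
    _ ≤ _ := by
        rw [measure_noneReach hind hB, measure_noneReach hind hB]
        refine mul_le_mul_of_nonneg_left ?_ (prod_nonneg fun _ _ => measureReal_nonneg)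
        refine prod_le_prod (fun _ _ => measureReal_nonneg) fun j hj => hshift _ _ _ ?_
        have := mem_range.1 hj
        omega

/-- Kochen–Stone with constant `2`: the two orderings of a pair of indices each contribute at most
the squared mean. -/
lemma frequently_noneReach_ne_zero (hm : ∀ j, m j ≤ ‹MeasurableSpace Ω›) (hind : iIndep m P)
    (hB : ∀ j k, MeasurableSet[m j] (B j k))
    (hmono : ∀ j k, 1 ≤ k → P.real (B (j + 1) k)ᶜ ≤ P.real (B j k)ᶜ)
    (hsum : ¬ Summable fun n => P.real (noneReach B n)) :
    P {ω | ∃ᶠ n in atTop, ω ∈ noneReach B n} ≠ 0 := by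
  have : IsProbabilityMeasure P := hind.isProbabilityMeasure
  refine measure_frequently_ne_zero
    (measurableSet_noneReach fun j k => hm j _ (hB j k)) two_pos ?_
    ((not_summable_iff_tendsto_nat_atTop_of_nonneg fun _ => measureReal_nonneg).1 hsum)
  intro N
  set a : ℕ → ℝ := fun n => P.real (noneReach B n) with ha
  have ha0 : ∀ n, 0 ≤ a n := fun n => measureReal_nonneg
  have hle : ∀ n k, n ≤ k → P.real (noneReach B n ∩ noneReach B k) ≤ a n * a (k - n) := by
    intro n k hnk
    have := measure_noneReach_inter_le hind hB hmono n (k - n)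
    rwa [Nat.add_sub_cancel' hnk] at this
  have hrow : ∀ n, ∑ k ∈ range N, (if n ≤ k then a n * a (k - n) else 0)
      ≤ a n * ∑ k ∈ range N, a k := by
    intro n
    rw [← sum_filter, ← mul_sum]
    refine mul_le_mul_of_nonneg_left ?_ (ha0 n)
    rw [← sum_image (f := a) (g := fun k => k - n)]
    · refine sum_le_sum_of_subset_of_nonneg ?_ fun _ _ _ => ha0 _
      intro k hk
      simp only [mem_image, mem_filter, mem_range] at hk ⊢
      omega
    · intro x hx y hy hxy
      simp only [coe_filter, mem_range, Set.mem_ofPred_eq] at hx hy hxy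
      omega
  calc ∑ n ∈ range N, ∑ k ∈ range N, P.real (noneReach B n ∩ noneReach B k)
      ≤ ∑ n ∈ range N, ∑ k ∈ range N, ((if n ≤ k then a n * a (k - n) else 0)
          + (if k ≤ n then a k * a (n - k) else 0)) := by
        refine sum_le_sum fun n _ => sum_le_sum fun k _ => ?_
        rcases le_total n k with h | h
        · rw [if_pos h]
          refine (hle n k h).trans (le_add_of_nonneg_right ?_)
          split_ifs
          exacts [mul_nonneg (ha0 _) (ha0 _), le_rfl]
        · rw [if_pos h, Set.inter_comm]
          refine (hle k n h).trans (le_add_of_nonneg_left ?_)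
          split_ifs
          exacts [mul_nonneg (ha0 _) (ha0 _), le_rfl]
    _ = 2 * ∑ n ∈ range N, ∑ k ∈ range N, (if n ≤ k then a n * a (k - n) else 0) := by
        simp only [sum_add_distrib]
        rw [two_mul]
        congr 1
        exact sum_comm
    _ ≤ 2 * ∑ n ∈ range N, a n * ∑ k ∈ range N, a k :=
        mul_le_mul_of_nonneg_left (sum_le_sum fun n _ => hrow n) two_pos.le
    _ = _ := by rw [← sum_mul, sq]

/-- The event that infinitely often none of the sites `j ∈ [K, n)` reaches distance `n - j`, for
some `K`. It is a tail event. -/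
def tailNoneReach {Ω : Type*} (B : ℕ → ℕ → Set Ω) : Set Ω :=
  ⋃ K, {ω | ∃ᶠ n in atTop, ∀ j, K ≤ j → j < n → ω ∉ B j (n - j)}

lemma tailNoneReach_zero_or_one (hm : ∀ j, m j ≤ ‹MeasurableSpace Ω›) (hind : iIndep m P)
    (hB : ∀ j k, MeasurableSet[m j] (B j k)) :
    P (tailNoneReach B) = 0 ∨ P (tailNoneReach B) = 1 := by
  refine measure_zero_or_one_of_measurableSet_limsup_atTop (s := m) hm hind ?_
  rw [limsup_eq_iInf_iSup_of_nat, MeasurableSpace.measurableSet_iInf]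
  intro L
  -- Raising `K` only weakens the condition, so `K ≥ L` may be assumed and the event depends only on
  -- sites from `L` on.
  have hset : tailNoneReach B
      = ⋃ K ∈ Set.Ici L, ⋂ N, ⋃ n ∈ Set.Ici N, ⋂ j ∈ Set.Ico K n, (B j (n - j))ᶜ := by
    ext ω
    simp only [tailNoneReach, Set.mem_iUnion, Set.mem_ofPred_eq, frequently_atTop, Set.mem_iInter,
      Set.mem_Ici, Set.mem_Ico, Set.mem_compl_iff, and_imp, exists_prop]
    constructor
    · rintro ⟨K, hK⟩
      refine ⟨max K L, le_max_right _ _, fun N => ?_⟩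
      obtain ⟨n, hn, h⟩ := hK N
      exact ⟨n, hn, fun j hj => h j (le_trans (le_max_left _ _) hj)⟩
    · rintro ⟨K, -, hK⟩
      exact ⟨K, hK⟩
  rw [hset]
  refine MeasurableSet.biUnion (Set.to_countable _) fun K hK => MeasurableSet.iInter fun N =>
    MeasurableSet.biUnion (Set.to_countable _) fun n _ =>
      MeasurableSet.biInter (Set.to_countable _) fun j hj => MeasurableSet.compl ?_
  exact (le_iSup₂_of_le (f := fun i (_ : i ≥ L) => m i) j (le_trans hK hj.1) le_rfl) _ (hB j _)

/-- If every site has finite reach, then on the tail event infinitely many sites are not reached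
from their left. -/
lemma frequently_noneReach_of_tail {Ω : Type*} {B : ℕ → ℕ → Set Ω}
    (hanti : ∀ j, Antitone (B j)) {ω : Ω}
    (hfin : ∀ j, ∃ k, ω ∉ B j k) (hω : ω ∈ tailNoneReach B) :
    ∃ᶠ n in atTop, ω ∈ noneReach B n := by
  simp only [tailNoneReach, Set.mem_iUnion, Set.mem_ofPred_eq] at hω
  obtain ⟨K, hK⟩ := hω
  choose k hk using hfin
  have hev : ∀ᶠ n in atTop, ∀ j ∈ range K, ω ∉ B j (n - j) := by
    rw [eventually_all_finset]
    intro j _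
    filter_upwards [eventually_ge_atTop (j + k j)] with n hn hmem
    exact hk j (hanti j (by omega : k j ≤ n - j) hmem)
  refine (hK.and_eventually hev).mono fun n hn => ?_
  rw [mem_noneReach]
  intro j hj
  by_cases hjK : j < K
  · exact hn.2 j (mem_range.2 hjK)
  · exact hn.1 j (not_lt.1 hjK) hj

/-- Zero-one law for a growing cluster: with independent reaches that are stochastically increasing
from site `1` on, almost surely some site `n ≥ 1` is not reached from its left if and only if
the probabilities of not being reached from `[1, n)` have infinite sum. -/
theorem ae_exists_noneReach_iff (hm : ∀ j, m j ≤ ‹MeasurableSpace Ω›) (hind : iIndep m P)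
    (hB : ∀ j k, MeasurableSet[m j] (B j k)) (hanti : ∀ j, Antitone (B j))
    (hmono : ∀ j k, 1 ≤ k → P.real (B (j + 2) k)ᶜ ≤ P.real (B (j + 1) k)ᶜ)
    (hfin : ∀ j, ∀ᵐ ω ∂P, ∃ k, ω ∉ B j k) (hzero : ∀ k, P (B 0 k) ≠ 0) :
    (∀ᵐ ω ∂P, ∃ n, 1 ≤ n ∧ ω ∈ noneReach B n)
      ↔ ¬ Summable fun n => P.real (noneReach (fun j => B (j + 1)) n) := by
  have : IsProbabilityMeasure P := hind.isProbabilityMeasure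
  set C : ℕ → ℕ → Set Ω := fun j => B (j + 1) with hC
  have hindC : iIndep (fun j => m (j + 1)) P := hind.precomp (add_left_injective 1)
  have hBm : ∀ j k, MeasurableSet (B j k) := fun j k => hm j _ (hB j k)
  constructor
  · intro h hsum
    have hne : ∑' n, P (noneReach C n) ≠ ∞ := by
      have := hsum.tsum_ofReal_ne_top
      simpa [ofReal_measureReal] using this
    have hae : ∀ᵐ ω ∂P, ∀ᶠ n in atTop, ω ∉ noneReach C n :=
      ae_eventually_notMem hne
    have hex : ∃ N, P {ω | ∀ n, N ≤ n → ω ∉ noneReach C n} ≠ 0 := by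
      by_contra hcon
      push Not at hcon
      have h0 : P (⋃ N, {ω | ∀ n, N ≤ n → ω ∉ noneReach C n}) = 0 :=
        measure_iUnion_null hcon
      have h1 : ∀ᵐ ω ∂P, ω ∈ (∅ : Set Ω) := by
        filter_upwards [hae, measure_eq_zero_iff_ae_notMem.1 h0] with ω h2 h3
        obtain ⟨N, hN⟩ := eventually_atTop.1 h2
        exact absurd (Set.mem_iUnion.2 ⟨N, by simpa using hN⟩) h3
      obtain ⟨ω, hω⟩ := h1.exists
      exact hω
    obtain ⟨N, hN⟩ := hex
    set G := {ω | ∀ n, N ≤ n → ω ∉ noneReach C n} with hG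
    have hind2 : Indep (⨆ i ∈ ({0} : Set ℕ), m i) (⨆ i ∈ Set.Ici 1, m i) P :=
      indep_iSup_of_disjoint hm hind (by simp)
    have hmem : ∀ (S : Set ℕ) j, j ∈ S → ∀ k, MeasurableSet[⨆ i ∈ S, m i] (B j k) :=
      fun S j hj k => (le_iSup₂_of_le (f := fun i (_ : i ∈ S) => m i) j hj le_rfl) _ (hB j k)
    have hGm : MeasurableSet[⨆ i ∈ Set.Ici 1, m i] G := by
      have : G = ⋂ n ∈ Set.Ici N, (⋂ j ∈ Set.Iio n, (B (j + 1) (n - j))ᶜ)ᶜ := by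
        ext ω
        simp [hG, mem_noneReach, hC]
      rw [this]
      exact MeasurableSet.biInter (Set.to_countable _) fun n _ => MeasurableSet.compl <|
        MeasurableSet.biInter (Set.to_countable _) fun j _ => MeasurableSet.compl <|
          hmem _ _ (by simp) _
    have hmul := (Indep_iff _ _ _).1 hind2 (B 0 (N + 1)) G (hmem _ _ (by simp) _) hGm
    -- On this intersection no site is missed: site `0` covers everything up to `N + 1`, and `G`
    -- covers the rest. `noneReach C n` concerns site `n + 1`.
    have hpos : P (B 0 (N + 1) ∩ G) ≠ 0 := by
      rw [hmul]
      exact mul_ne_zero (hzero _) hN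
    refine hpos (measure_mono_null ?_ (ae_iff.1 h))
    rintro ω ⟨h1, h2⟩ ⟨n, hn, h3⟩
    rw [mem_noneReach] at h3
    rcases Nat.lt_or_ge N (n - 1) with hlt | hle
    · refine h2 (n - 1) hlt.le ?_
      rw [mem_noneReach]
      intro j hj
      have := h3 (j + 1) (by omega)
      rwa [show n - (j + 1) = n - 1 - j by omega] at this
    · exact h3 0 hn (hanti 0 (by omega : n - 0 ≤ N + 1) h1)
  · intro hsum
    have h1 := frequently_noneReach_ne_zero (fun j => hm (j + 1)) hindC
      (fun j k => hB (j + 1) k) hmono hsum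
    have hsub : {ω | ∃ᶠ n in atTop, ω ∈ noneReach C n} ⊆ tailNoneReach B := by
      intro ω hω
      refine Set.mem_iUnion.2 ⟨1, ?_⟩
      simp only [Set.mem_ofPred_eq, frequently_atTop] at hω ⊢
      intro N
      obtain ⟨n, hn, h⟩ := hω N
      refine ⟨n + 1, by omega, fun j hj hjn hmem => ?_⟩
      rw [mem_noneReach] at h
      refine h (j - 1) (by omega) ?_
      simp only [hC]
      rwa [show j - 1 + 1 = j by omega, show n - (j - 1) = n + 1 - j by omega]
    have h2 : P (tailNoneReach B) = 1 :=
      (tailNoneReach_zero_or_one hm hind hB).resolve_left fun h0 => h1 (measure_mono_null hsub h0)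
    have hmeas : MeasurableSet (tailNoneReach B) := by
      have : tailNoneReach B
          = ⋃ K, ⋂ N, ⋃ n ∈ Set.Ici N, ⋂ j ∈ Set.Ico K n, (B j (n - j))ᶜ := by
        ext ω
        simp [tailNoneReach, frequently_atTop]
      rw [this]
      exact MeasurableSet.iUnion fun K => MeasurableSet.iInter fun N =>
        MeasurableSet.biUnion (Set.to_countable _) fun n _ =>
          MeasurableSet.biInter (Set.to_countable _) fun j _ => (hBm _ _).compl
    have h3 : ∀ᵐ ω ∂P, ω ∈ tailNoneReach B := (mem_ae_iff_prob_eq_one hmeas).2 h2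
    filter_upwards [h3, ae_all_iff.2 hfin] with ω h4 h5
    obtain ⟨n, hn, h6⟩ := frequently_atTop.1 (frequently_noneReach_of_tail hanti h5 h4) 1
    exact ⟨n, hn, h6⟩

end Blocking

end FrogModel

namespace FrogModel
open Filter Finset
open scoped ENNReal Topology

/-! ### Random walk with drift to the left -/

section Walk

variable {Ω : Type*} [MeasurableSpace Ω] {P : Measure Ω}

/-- The steps `w 0, w 1, …` are those of a nearest-neighbour walk on `ℤ`, with independent steps
that are `-1` with probability `p` and `1` with probability `1 - p`. -/
structure IsWalk (P : Measure Ω) (p : ℝ) (w : ℕ → Ω → ℤ) : Prop where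
  measurable_step : ∀ n, Measurable (w n)
  indep : iIndepFun w P
  half_lt : 1 / 2 < p
  lt_one : p < 1
  step_left : ∀ n, P {ω | w n ω = -1} = ENNReal.ofReal p
  step_right : ∀ n, P {ω | w n ω = 1} = ENNReal.ofReal (1 - p)

namespace IsWalk

variable {p : ℝ} {w : ℕ → Ω → ℤ} (hw : IsWalk P p w)
include hw

lemma isProbabilityMeasure : IsProbabilityMeasure P := hw.indep.isProbabilityMeasure

lemma measurableSet_eq (n : ℕ) (z : ℤ) : MeasurableSet {ω | w n ω = z} :=
  hw.measurable_step n (measurableSet_singleton z)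

lemma step_eq (n : ℕ) : ∀ᵐ ω ∂P, w n ω = -1 ∨ w n ω = 1 := by
  have := hw.isProbabilityMeasure
  have hm : MeasurableSet ({ω | w n ω = -1} ∪ {ω | w n ω = 1}) :=
    (hw.measurableSet_eq n _).union (hw.measurableSet_eq n _)
  have h1 : P ({ω | w n ω = -1} ∪ {ω | w n ω = 1}) = 1 := by
    rw [measure_union _ (hw.measurableSet_eq n 1), hw.step_left, hw.step_right,
      ← ENNReal.ofReal_add (by linarith [hw.half_lt]) (by linarith [hw.lt_one])]
    · simp
    · rw [Set.disjoint_left]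
      intro ω h1 h2
      simp only [Set.mem_ofPred_eq] at h1 h2
      omega
  exact (mem_ae_iff_prob_eq_one hm).2 h1

lemma comp_ae_eq (f : ℤ → ℝ) (n : ℕ) : (fun ω => f (w n ω)) =ᵐ[P] fun ω =>
    {ω | w n ω = -1}.indicator (fun _ => f (-1)) ω + {ω | w n ω = 1}.indicator (fun _ => f 1) ω := by
  filter_upwards [hw.step_eq n] with ω hω
  rcases hω with h | h <;> simp [h]

lemma integrable_comp (f : ℤ → ℝ) (n : ℕ) : Integrable (fun ω => f (w n ω)) P := by
  have := hw.isProbabilityMeasure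
  rw [integrable_congr (hw.comp_ae_eq f n)]
  exact ((integrable_const _).indicator (hw.measurableSet_eq n _)).add
    ((integrable_const _).indicator (hw.measurableSet_eq n _))

lemma integral_comp (f : ℤ → ℝ) (n : ℕ) :
    ∫ ω, f (w n ω) ∂P = p * f (-1) + (1 - p) * f 1 := by
  have := hw.isProbabilityMeasure
  rw [integral_congr_ae (hw.comp_ae_eq f n),
    integral_add ((integrable_const _).indicator (hw.measurableSet_eq n _))
      ((integrable_const _).indicator (hw.measurableSet_eq n _)),
    integral_indicator_const _ (hw.measurableSet_eq n _),
    integral_indicator_const _ (hw.measurableSet_eq n _), measureReal_def, measureReal_def,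
    hw.step_left, hw.step_right, ENNReal.toReal_ofReal (by linarith [hw.half_lt]),
    ENNReal.toReal_ofReal (by linarith [hw.lt_one])]
  simp

lemma identDistrib (n : ℕ) : IdentDistrib (w n) (w 0) P P where
  aemeasurable_fst := (hw.measurable_step n).aemeasurable
  aemeasurable_snd := (hw.measurable_step 0).aemeasurable
  map_eq := by
    refine Measure.ext_of_singleton fun z => ?_
    rw [Measure.map_apply (hw.measurable_step n) (measurableSet_singleton z),
      Measure.map_apply (hw.measurable_step 0) (measurableSet_singleton z)]
    change P {ω | w n ω = z} = P {ω | w 0 ω = z}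
    by_cases h1 : z = -1
    · rw [h1, hw.step_left, hw.step_left]
    by_cases h2 : z = 1
    · rw [h2, hw.step_right, hw.step_right]
    have : ∀ n, P {ω | w n ω = z} = 0 := by
      intro n
      refine measure_mono_null ?_ (ae_iff.1 (hw.step_eq n))
      rintro ω rfl
      simp [h1, h2]
    rw [this, this]

lemma tendsto_atBot : ∀ᵐ ω ∂P, Tendsto (fun m => ∑ n ∈ range m, w n ω) atTop atBot := by
  have h := strong_law_ae_real (μ := P) (fun n ω => ((w n ω : ℤ) : ℝ))
    (hw.integrable_comp (fun z => (z : ℝ)) 0)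
    (fun i j hij => (hw.indep.indepFun hij).comp (φ := fun z : ℤ => (z : ℝ))
      (ψ := fun z : ℤ => (z : ℝ)) (by fun_prop) (by fun_prop))
    (fun i => (hw.identDistrib i).comp (u := fun z : ℤ => (z : ℝ)) (by fun_prop))
  have hE := hw.integral_comp (fun z => (z : ℝ)) 0
  filter_upwards [h] with ω hω
  rw [hE] at hω
  have hneg : p * ((-1 : ℤ) : ℝ) + (1 - p) * ((1 : ℤ) : ℝ) < 0 := by
    push_cast; linarith [hw.half_lt]
  have h2 := hω.neg_mul_atTop hneg tendsto_natCast_atTop_atTop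
  rw [← tendsto_intCast_atBot_iff (R := ℝ)]
  refine h2.congr' ?_
  filter_upwards [eventually_gt_atTop 0] with m hm
  have : (m : ℝ) ≠ 0 := by positivity
  push_cast
  field_simp

/-- Gambler's ruin: the walk reaches height `k` with probability `((1 - p) / p) ^ k`. -/
lemma measure_reach (k : ℕ) :
    P.real {ω | ∃ m, (k : ℤ) ≤ ∑ n ∈ range m, w n ω} = ((1 - p) / p) ^ k := by
  have := hw.isProbabilityMeasure
  have hp0 : 0 < p := by linarith [hw.half_lt]
  have hp1 : 0 < 1 - p := by linarith [hw.lt_one]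
  -- This ratio makes `r ^ S m` a martingale: `p * r⁻¹ + (1 - p) * r = 1`.
  set r : ℝ := p / (1 - p) with hr
  have hr1 : 1 < r := by rw [hr, one_lt_div hp1]; linarith [hw.half_lt]
  have hr0 : 0 < r := by positivity
  set S : ℕ → Ω → ℤ := fun m ω => ∑ n ∈ range m, w n ω with hS
  set H : ℕ → Set Ω := fun m => {ω | ∃ l ≤ m, (k : ℤ) ≤ S l ω} with hH
  set F : ℕ → MeasurableSpace Ω := fun m => ⨆ i ∈ Set.Iio m,
    MeasurableSpace.comap (w i) inferInstance with hF
  have hSF : ∀ l m, l ≤ m → Measurable[F m] (S l) := by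
    intro l m hlm
    refine Finset.measurable_sum _ fun n hn => ?_
    rw [measurable_iff_comap_le]
    exact le_iSup₂_of_le (f := fun i (_ : i ∈ Set.Iio m) =>
      MeasurableSpace.comap (w i) inferInstance) n
      (lt_of_lt_of_le (mem_range.1 hn) hlm) le_rfl
  have hFle : ∀ m, F m ≤ ‹MeasurableSpace Ω› := fun m =>
    iSup₂_le fun i _ => (hw.measurable_step i).comap_le
  have hHF : ∀ m, MeasurableSet[F m] (H m) := by
    intro m
    have : H m = ⋃ l ∈ Set.Iic m, S l ⁻¹' Set.Ici (k : ℤ) := by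
      ext ω; simp [hH]
    rw [this]
    exact MeasurableSet.biUnion (Set.to_countable _) fun l hl =>
      hSF l m hl (measurableSet_Ici)
  have hHm : ∀ m, MeasurableSet (H m) := fun m => hFle m _ (hHF m)
  have hSm : ∀ m, Measurable (S m) := fun m => (hSF m m le_rfl).mono (hFle m) le_rfl
  set Z : ℕ → Ω → ℝ := fun m => (H m)ᶜ.indicator fun ω => r ^ (S m ω) with hZ
  have hZF : ∀ m, Measurable[F m] (Z m) := fun m =>
    Measurable.indicator ((measurable_of_countable (fun z : ℤ => r ^ z)).comp (hSF m m le_rfl))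
      (hHF m).compl
  have hZm : ∀ m, Measurable (Z m) := fun m => (hZF m).mono (hFle m) le_rfl
  have hlt : ∀ m ω, ω ∉ H m → S m ω < k := by
    intro m ω h
    by_contra hcon
    exact h ⟨m, le_rfl, not_lt.1 hcon⟩
  have hZ0 : ∀ m ω, 0 ≤ Z m ω := fun m ω => Set.indicator_nonneg (fun _ _ => by positivity) ω
  have hZk : ∀ m ω, Z m ω ≤ r ^ k := by
    intro m ω
    by_cases h : ω ∈ H m
    · simp only [hZ, Set.mem_compl_iff, h, not_true, not_false_eq_true, Set.indicator_of_notMem]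
      positivity
    · simp only [hZ, Set.mem_compl_iff, h, not_false_eq_true, Set.indicator_of_mem]
      rw [← zpow_natCast]
      exact zpow_le_zpow_right₀ hr1.le (hlt m ω h).le
  have hZint : ∀ m, Integrable (Z m) P := fun m =>
    Integrable.of_bound (hZm m).aestronglyMeasurable (r ^ k) (ae_of_all _ fun ω => by
      rw [Real.norm_of_nonneg (hZ0 m ω)]; exact hZk m ω)
  -- The martingale stopped on reaching `k`. Steps of size one cannot overshoot, so its stopped
  -- value is exactly `r ^ k`.
  set Y : ℕ → Ω → ℝ := fun m ω => (H m).indicator (fun _ => r ^ k) ω + Z m ω with hY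
  have hYint : ∀ m, Integrable (Y m) P := fun m =>
    ((integrable_const _).indicator (hHm m)).add (hZint m)
  have hstep : ∀ m, ∫ ω, Y (m + 1) ω ∂P = ∫ ω, Y m ω ∂P := by
    intro m
    have hdiff : ∀ᵐ ω ∂P, Y (m + 1) ω - Y m ω = Z m ω * (r ^ (w m ω) - 1) := by
      filter_upwards [hw.step_eq m] with ω hω
      have hsucc : S (m + 1) ω = S m ω + w m ω := by simp [hS, sum_range_succ]
      by_cases h : ω ∈ H m
      · have h' : ω ∈ H (m + 1) := by
          obtain ⟨l, hl, h⟩ := h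
          exact ⟨l, by omega, h⟩
        simp [hY, hZ, h, h']
      · have hlt' := hlt m ω h
        have hpow : r ^ (S (m + 1) ω) = r ^ (S m ω) * r ^ (w m ω) := by
          rw [hsucc, zpow_add₀ hr0.ne']
        by_cases h' : ω ∈ H (m + 1)
        · have hk : (k : ℤ) ≤ S (m + 1) ω := by
            obtain ⟨l, hl, hl'⟩ := h'
            rcases Nat.lt_or_ge m l with hml | hml
            · rwa [show l = m + 1 by omega] at hl'
            · exact absurd ⟨l, hml, hl'⟩ h
          have hke : S (m + 1) ω = k := by omega
          rw [hke, zpow_natCast] at hpow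
          simp [hY, hZ, h, h', hpow]
          ring
        · simp [hY, hZ, h, h', hpow]
          ring
    have hindep : IndepFun (Z m) (fun ω => r ^ (w m ω) - 1) P := by
      have h1 : Indep (F m) (⨆ i ∈ ({m} : Set ℕ), MeasurableSpace.comap (w i) inferInstance) P :=
        indep_iSup_of_disjoint (fun i => (hw.measurable_step i).comap_le)
          ((iIndepFun_iff_iIndep _ _ _).1 hw.indep) (by simp)
      simp only [Set.mem_singleton_iff, iSup_iSup_eq_left] at h1
      refine (IndepFun_iff_Indep _ _ _).2 (indep_of_indep_of_le_left
        (indep_of_indep_of_le_right h1 ?_) (measurable_iff_comap_le.1 (hZF m)))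
      rw [← measurable_iff_comap_le]
      exact (measurable_of_countable (fun z : ℤ => r ^ z - 1)).comp (comap_measurable (w m))
    have hzero : ∫ ω, (r ^ (w m ω) - 1) ∂P = 0 := by
      rw [hw.integral_comp (fun z => r ^ z - 1) m]
      simp only [zpow_neg, zpow_one, hr]
      field_simp
      ring
    rw [← sub_eq_zero, ← integral_sub (hYint _) (hYint _), integral_congr_ae hdiff,
      hindep.integral_fun_mul_eq_mul_integral (hZm m).aestronglyMeasurable
        (hw.integrable_comp (fun z => r ^ z - 1) m).aestronglyMeasurable, hzero, mul_zero]
  have hY1 : ∀ m, ∫ ω, Y m ω ∂P = 1 := by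
    intro m
    induction m with
    | zero =>
      have : ∀ ω, Y 0 ω = 1 := by
        intro ω
        rcases Nat.eq_zero_or_pos k with h | h
        · simp [hY, hZ, hH, hS, h]
        · simp [hY, hZ, hH, hS, h.ne']
      simp [this]
    | succ m ih => rw [hstep, ih]
  set R : Set Ω := {ω | ∃ m, (k : ℤ) ≤ S m ω} with hR
  have hRm : MeasurableSet R := by
    have : R = ⋃ m, H m := by
      ext ω
      simp only [hR, hH, Set.mem_ofPred_eq, Set.mem_iUnion]
      exact ⟨fun ⟨m, h⟩ => ⟨m, m, le_rfl, h⟩, fun ⟨_, l, _, h⟩ => ⟨l, h⟩⟩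
    rw [this]
    exact MeasurableSet.iUnion hHm
  -- Off `R` the walk tends to `-∞`, so the stopped martingale vanishes in the limit; dominated
  -- convergence then gives `1 = P.real R * r ^ k`.
  have hlim : ∀ᵐ ω ∂P, Tendsto (fun m => Y m ω) atTop (𝓝 (R.indicator (fun _ => r ^ k) ω)) := by
    filter_upwards [hw.tendsto_atBot] with ω hω
    by_cases h : ω ∈ R
    · obtain ⟨l, hl⟩ := id h
      refine tendsto_const_nhds.congr' ?_
      filter_upwards [eventually_ge_atTop l] with m hm
      have : ω ∈ H m := ⟨l, hm, hl⟩
      simp [hY, hZ, h, this]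
    · have h' : ∀ m, ω ∉ H m := fun m ⟨l, _, hl⟩ => h ⟨l, hl⟩
      simp only [hY, hZ, h, h', Set.mem_compl_iff, not_false_eq_true, Set.indicator_of_notMem,
        Set.indicator_of_mem, zero_add]
      have h3 : Tendsto (fun m => (r⁻¹) ^ (-(S m ω)).toNat) atTop (𝓝 0) := by
        refine (tendsto_pow_atTop_nhds_zero_of_lt_one (by positivity)
          (inv_lt_one_of_one_lt₀ hr1)).comp ?_
        rw [tendsto_atTop]
        intro b
        filter_upwards [hω.eventually_le_atBot (-(b : ℤ))] with m hm
        simp only [hS]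
        omega
      refine h3.congr' ?_
      filter_upwards [hω.eventually_le_atBot 0] with m hm
      rw [← zpow_natCast, inv_zpow, ← zpow_neg]
      congr 1
      simp only [hS]
      omega
  have hdct := tendsto_integral_of_dominated_convergence (μ := P) (fun _ => r ^ k + r ^ k)
    (fun m => (hYint m).aestronglyMeasurable) (integrable_const _) (fun m => ae_of_all _ fun ω => by
      have h1 : 0 ≤ (H m).indicator (fun _ => r ^ k) ω :=
        Set.indicator_nonneg (fun _ _ => by positivity) ω
      have h2 : (H m).indicator (fun _ => r ^ k) ω ≤ r ^ k :=
        Set.indicator_le_self' (fun _ _ => by positivity) ω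
      rw [Real.norm_of_nonneg (add_nonneg h1 (hZ0 m ω))]
      exact add_le_add h2 (hZk m ω)) hlim
  simp only [hY1] at hdct
  have hone := tendsto_nhds_unique tendsto_const_nhds hdct
  rw [integral_indicator_const _ hRm, smul_eq_mul] at hone
  have : (1 - p) / p = r⁻¹ := by rw [hr, inv_div]
  rw [this, inv_pow]
  exact eq_inv_of_mul_eq_one_left hone.symm

end IsWalk

/-- A walk on `ℤ` with steps `±1` attains all values between two of its values. -/
lemma exists_partialSum_eq {v : ℕ → ℤ} (hv : ∀ n, v n = -1 ∨ v n = 1) {m : ℕ} {z : ℤ}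
    (h : (0 ≤ z ∧ z ≤ ∑ n ∈ range m, v n) ∨ (z ≤ 0 ∧ ∑ n ∈ range m, v n ≤ z)) :
    ∃ l ≤ m, ∑ n ∈ range l, v n = z := by
  induction m with
  | zero => exact ⟨0, le_rfl, by simp at h ⊢; omega⟩
  | succ m ih =>
    by_cases heq : ∑ n ∈ range (m + 1), v n = z
    · exact ⟨m + 1, le_rfl, heq⟩
    · have := hv m
      rw [sum_range_succ] at h heq
      obtain ⟨l, hl, h⟩ := ih (by omega)
      exact ⟨l, by omega, h⟩

end Walk

end FrogModel

namespace FrogModel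
open Filter Finset

/-! ### Deterministic dynamics -/

section Dynamics

variable {x : ℕ → ℕ} {ξ : ℕ → ℕ → ℕ → ℤ}

/-- Some frog from site `j` moves at least `k` sites to the right of `j` once it is awake. -/
def Reaches (x : ℕ → ℕ) (ξ : ℕ → ℕ → ℕ → ℤ) (j k : ℕ) : Prop :=
  ∃ i < x j, ∃ m, (k : ℤ) ≤ ∑ n ∈ range m, ξ j i n

lemma Reaches.mono {j k l : ℕ} (hkl : k ≤ l) (h : Reaches x ξ j l) : Reaches x ξ j k := by
  obtain ⟨i, hi, m, hm⟩ := h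
  exact ⟨i, hi, m, le_trans (by exact_mod_cast hkl) hm⟩

lemma state_add {t j a : ℕ} (h : state x ξ t j = some a) (s : ℕ) :
    state x ξ (t + s) j = some (a + s) := by
  induction s with
  | zero => exact h
  | succ s ih => simp [← add_assoc, state, ih]

lemma exists_state_eq_zero {t j a : ℕ} (h : state x ξ t j = some a) :
    ∃ t₀, state x ξ t₀ j = some 0 := by
  induction t generalizing a with
  | zero =>
    by_cases hj : j = 0
    · exact ⟨0, by simp [state, hj]⟩
    · simp [state, hj] at h
  | succ t ih =>
    cases hs : state x ξ t j with
    | some b => exact ih hs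
    | none =>
      refine ⟨t + 1, ?_⟩
      simp only [state, hs] at h ⊢
      split_ifs at h ⊢ with hc
      rfl

lemma awake_of_position_eq {t k i m j : ℕ} (h : state x ξ t k = some 0) (hi : i < x k)
    (hpos : position ξ k i (m + 1) = j) : ∃ t a, state x ξ t j = some a := by
  have hm : state x ξ (t + m) k = some m := by simpa using state_add h m
  refine ⟨t + m + 1, ?_⟩
  cases hs : state x ξ (t + m) j with
  | some b => exact ⟨b + 1, by simp [state, hs]⟩
  | none =>
    refine ⟨0, ?_⟩
    simp only [state, hs]
    rw [if_pos ⟨k, m, i, hm, hi, hpos⟩]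

/-- If no frog from `[0, n)` reaches `n`, then the frogs from `n` on are never woken up. -/
lemma lt_of_awake {n : ℕ} (hn : 1 ≤ n) (h : ∀ j < n, ¬ Reaches x ξ j (n - j)) {t j a : ℕ}
    (hs : state x ξ t j = some a) : j < n := by
  induction t generalizing j a with
  | zero =>
    by_cases hj : j = 0
    · omega
    · simp [state, hj] at hs
  | succ t ih =>
    cases hs' : state x ξ t j with
    | some b => exact ih hs'
    | none =>
      simp only [state, hs'] at hs
      split_ifs at hs with hc
      obtain ⟨k, b, i, hk, hi, hpos⟩ := hc
      by_contra hjn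
      have hkn := ih hk
      refine h k hkn ⟨i, hi, b + 1, ?_⟩
      simp only [position] at hpos
      omega

lemma finite_hitsOrigin {n : ℕ} (hn : 1 ≤ n) (h : ∀ j < n, ¬ Reaches x ξ j (n - j)) :
    {f : ℕ × ℕ | HitsOrigin x ξ f.1 f.2}.Finite := by
  refine ((range n).finite_toSet.biUnion fun j _ =>
    ((range (x j)).finite_toSet.image (Prod.mk j))).subset ?_
  rintro ⟨j, i⟩ ⟨hi, t, a, hs, -⟩
  simp only [Set.mem_iUnion]
  exact ⟨j, by simpa using lt_of_awake hn h hs, i, by simpa using hi, rfl⟩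

/-- If every site `n ≥ 1` is reached from its left, then all sites are woken up. -/
lemma exists_awake (hξ : ∀ j i n, ξ j i n = -1 ∨ ξ j i n = 1)
    (h : ∀ n, 1 ≤ n → ∃ j < n, Reaches x ξ j (n - j)) (n : ℕ) :
    ∃ t, state x ξ t n = some 0 := by
  induction n using Nat.strong_induction_on with
  | _ n ih =>
    rcases Nat.eq_zero_or_pos n with rfl | hn
    · exact ⟨0, by simp [state]⟩
    · obtain ⟨j, hj, i, hi, m, hm⟩ := h n hn
      obtain ⟨t, ht⟩ := ih j hj
      obtain ⟨l, -, hl⟩ := exists_partialSum_eq (hξ j i) (Or.inl ⟨by positivity, hm⟩)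
      have hl0 : l ≠ 0 := by
        rintro rfl
        simp at hl
        omega
      obtain ⟨l, rfl⟩ := Nat.exists_eq_succ_of_ne_zero hl0
      have hpos : position ξ j i (l + 1) = n := by
        rw [position, hl]
        omega
      obtain ⟨t', a, h'⟩ := awake_of_position_eq ht hi hpos
      exact exists_state_eq_zero h'

/-- Every site wakes up, and a frog whose path tends to `-∞` in unit steps cannot jump over the
origin. Frog `0` of each occupied site suffices. -/
lemma infinite_hitsOrigin (hξ : ∀ j i n, ξ j i n = -1 ∨ ξ j i n = 1)
    (hbot : ∀ j i, Tendsto (fun m => ∑ n ∈ range m, ξ j i n) atTop atBot)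
    (hx : ∃ᶠ j in atTop, x j ≠ 0) (h : ∀ n, 1 ≤ n → ∃ j < n, Reaches x ξ j (n - j)) :
    {f : ℕ × ℕ | HitsOrigin x ξ f.1 f.2}.Infinite := by
  refine Set.Infinite.mono ?_ (((Nat.frequently_atTop_iff_infinite).1 hx).image
    (f := fun j => (j, 0)) (fun a _ b _ hab => (Prod.ext_iff.1 hab).1))
  rintro _ ⟨j, hj, rfl⟩
  obtain ⟨t, ht⟩ := exists_awake hξ h j
  obtain ⟨m, hm⟩ := ((hbot j 0).eventually_le_atBot (-(j : ℤ))).exists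
  obtain ⟨l, -, hl⟩ := exists_partialSum_eq (hξ j 0) (Or.inr ⟨by omega, hm⟩)
  refine ⟨Nat.pos_of_ne_zero hj, t + l, l, by simpa using state_add ht l, ?_⟩
  simp [position, hl]

end Dynamics

end FrogModel

namespace FrogModel
open Filter Finset
open scoped ENNReal Topology

/-! ### Independence of pairs and of rows -/

section Independence

variable {Ω ι κ α β : Type*} [MeasurableSpace Ω] {P : Measure Ω} [MeasurableSpace α]
  [MeasurableSpace β]

/-- If two independent families each consist of independent random variables, then the pairs of
corresponding members are independent. -/
lemma iIndepFun_prodMk {f : ι → Ω → α} {g : ι → Ω → β} (hf : ∀ i, Measurable (f i))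
    (hg : ∀ i, Measurable (g i)) (hfi : iIndepFun f P) (hgi : iIndepFun g P)
    (hfg : IndepFun (fun ω i => f i ω) (fun ω i => g i ω) P) :
    iIndepFun (fun i ω => (f i ω, g i ω)) P := by
  rw [iIndepFun_iff_iIndep]
  refine iIndepSets.iIndep (fun i => ((hf i).prodMk (hg i)).comap_le)
    (fun i => Set.preimage (fun ω => (f i ω, g i ω)) '' Set.image2 (· ×ˢ ·)
      {s : Set α | MeasurableSet s} {t : Set β | MeasurableSet t})
    (fun i => isPiSystem_prod.comap _) (fun i => ?_) ?_
  · rw [← generateFrom_prod, MeasurableSpace.comap_generateFrom]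
  · rw [iIndepSets_iff]
    intro S F hF
    have hF' : ∀ i, ∃ A : Set α, ∃ B : Set β, i ∈ S → MeasurableSet A ∧ MeasurableSet B ∧
        F i = f i ⁻¹' A ∩ g i ⁻¹' B := by
      intro i
      by_cases hi : i ∈ S
      · obtain ⟨_, ⟨A, hA, B, hB, rfl⟩, h⟩ := hF i hi
        exact ⟨A, B, fun _ => ⟨hA, hB, by rw [← h]; rfl⟩⟩
      · exact ⟨∅, ∅, fun h => absurd h hi⟩
    choose A B hAB using hF'
    have hset : ⋂ i ∈ S, F i = (fun ω i => f i ω) ⁻¹' (⋂ i ∈ S, Function.eval i ⁻¹' A i) ∩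
        (fun ω i => g i ω) ⁻¹' (⋂ i ∈ S, Function.eval i ⁻¹' B i) := by
      ext ω
      simp only [Set.mem_iInter, Set.mem_inter_iff, Set.mem_preimage, Function.eval]
      rw [← forall₂_and]
      refine forall₂_congr fun i hi => ?_
      rw [(hAB i hi).2.2]
      rfl
    rw [hset, hfg.measure_inter_preimage_eq_mul _ _
      (Finset.measurableSet_biInter _ fun i hi => measurable_pi_apply i (hAB i hi).1)
      (Finset.measurableSet_biInter _ fun i hi => measurable_pi_apply i (hAB i hi).2.1)]
    simp only [Set.preimage_iInter]
    have h1 := hfi.measure_inter_preimage_eq_mul S fun i hi => (hAB i hi).1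
    have h2 := hgi.measure_inter_preimage_eq_mul S fun i hi => (hAB i hi).2.1
    have h3 : ∏ i ∈ S, P (F i) = ∏ i ∈ S, P (f i ⁻¹' A i) * P (g i ⁻¹' B i) := by
      refine prod_congr rfl fun i hi => ?_
      have h4 := (hfg.comp (measurable_pi_apply i) (measurable_pi_apply i))
      rw [(hAB i hi).2.2]
      exact h4.measure_inter_preimage_eq_mul _ _ (hAB i hi).1 (hAB i hi).2.1
    rw [h3, prod_mul_distrib, ← h1, ← h2]
    rfl

/-- The rows of a matrix of independent random variables are independent. -/
lemma iIndepFun_rows [Countable ι] [Countable κ] {f : ι → κ → Ω → α}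
    (hf : ∀ i j, Measurable (f i j)) (h : iIndepFun (fun q : ι × κ => f q.1 q.2) P) :
    iIndepFun (fun i ω j => f i j ω) P := by
  have : IsProbabilityMeasure P := h.isProbabilityMeasure
  have : ∀ i j, IsProbabilityMeasure (P.map (f i j)) := fun i j =>
    Measure.isProbabilityMeasure_map (hf i j).aemeasurable
  have hrow : ∀ i, iIndepFun (f i) P := fun i =>
    h.precomp (g := fun j => (i, j)) fun a b hab => (Prod.ext_iff.1 hab).2
  rw [iIndepFun_iff_map_fun_eq_infinitePi_map (fun i => measurable_pi_iff.2 (hf i))]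
  have h1 := (iIndepFun_iff_map_fun_eq_infinitePi_map
    (X := fun q : ι × κ => f q.1 q.2) (fun q => hf q.1 q.2)).1 h
  have h2 := Measure.infinitePi_map_curry (fun i j => P.map (f i j))
  rw [← h1, Measure.map_map (by fun_prop) (by fun_prop)] at h2
  refine h2.trans ?_
  congr 1
  ext1 i
  exact ((iIndepFun_iff_map_fun_eq_infinitePi_map (hf i)).1 (hrow i)).symm

end Independence

/-! ### Generating functions and stochastic order -/

section Pgf

variable {Ω : Type*} [MeasurableSpace Ω] {P : Measure Ω} [IsProbabilityMeasure P] {Y Y' : Ω → ℕ}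

/-- By the layer-cake formula only the sets `{t < g}` matter; for antitone `g` they are initial
segments, whose complements are the tails compared by `StochLE`. -/
lemma lintegral_comp_le_of_stochLE (hY : Measurable Y) (hY' : Measurable Y')
    (h : StochLE P Y Y') {g : ℕ → ℝ} (hg : Antitone g) (hg0 : ∀ k, 0 ≤ g k) :
    ∫⁻ ω, ENNReal.ofReal (g (Y' ω)) ∂P ≤ ∫⁻ ω, ENNReal.ofReal (g (Y ω)) ∂P := by
  rw [lintegral_eq_lintegral_meas_lt P (ae_of_all _ fun ω => hg0 _)
      ((measurable_of_countable g).comp hY').aemeasurable,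
    lintegral_eq_lintegral_meas_lt P (ae_of_all _ fun ω => hg0 _)
      ((measurable_of_countable g).comp hY).aemeasurable]
  refine lintegral_mono fun t => ?_
  by_cases hall : ∀ k, t < g k
  · simp [hall]
  · push Not at hall
    classical
    have heq : ∀ k, t < g k ↔ k < Nat.find hall := by
      intro k
      constructor
      · intro hk
        by_contra hcon
        exact absurd (Nat.find_spec hall) (not_le.2 (hk.trans_le (hg (not_lt.1 hcon))))
      · intro hk
        exact not_le.1 (Nat.find_min hall hk)
    have hcompl : ∀ Z : Ω → ℕ, {ω | t < g (Z ω)} = {ω | Nat.find hall ≤ Z ω}ᶜ := by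
      intro Z
      ext ω
      rw [Set.mem_compl_iff, Set.mem_ofPred_eq, Set.mem_ofPred_eq, heq, not_le]
    rw [hcompl, hcompl, prob_compl_eq_one_sub (measurableSet_le measurable_const hY'),
      prob_compl_eq_one_sub (measurableSet_le measurable_const hY)]
    exact tsub_le_tsub_left (h _) _

lemma ofReal_pgf (hY : Measurable Y) {s : ℝ} (h0 : 0 ≤ s) (h1 : s ≤ 1) :
    ENNReal.ofReal (pgf P Y s) = ∫⁻ ω, ENNReal.ofReal (s ^ Y ω) ∂P := by
  have hsum : Summable fun k => P.real {ω | Y ω = k} := by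
    have := summable_measure_toReal (μ := P) (f := fun k => {ω | Y ω = k})
      (fun k => hY (measurableSet_singleton k))
      (fun a b hab => Set.disjoint_left.2 fun ω (ha : Y ω = a) (hb : Y ω = b) =>
        hab (ha.symm.trans hb))
    exact this
  rw [pgf, ENNReal.ofReal_tsum_of_nonneg
    (fun k => mul_nonneg measureReal_nonneg (pow_nonneg h0 k))
    (hsum.of_nonneg_of_le (fun k => mul_nonneg measureReal_nonneg (pow_nonneg h0 k))
      fun k => mul_le_of_le_one_right measureReal_nonneg (pow_le_one₀ h0 h1)),
    ← lintegral_map (f := fun k : ℕ => ENNReal.ofReal (s ^ k)) (measurable_of_countable _) hY,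
    lintegral_countable']
  refine tsum_congr fun k => ?_
  rw [ENNReal.ofReal_mul measureReal_nonneg, mul_comm, ofReal_measureReal,
    Measure.map_apply hY (measurableSet_singleton k)]
  rfl

lemma pgf_nonneg {Ω : Type*} [MeasurableSpace Ω] {P : Measure Ω} {Y : Ω → ℕ} {s : ℝ} (h0 : 0 ≤ s) : 0 ≤ pgf P Y s :=
  tsum_nonneg fun k => mul_nonneg measureReal_nonneg (pow_nonneg h0 k)

lemma pgf_le_pgf (hY : Measurable Y) (hY' : Measurable Y') (h : StochLE P Y Y') {s s' : ℝ}
    (h0 : 0 ≤ s') (hs : s' ≤ s) (h1 : s ≤ 1) : pgf P Y' s' ≤ pgf P Y s := by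
  rw [← ENNReal.ofReal_le_ofReal_iff (pgf_nonneg (h0.trans hs)),
    ofReal_pgf hY' h0 (hs.trans h1), ofReal_pgf hY (h0.trans hs) h1]
  calc ∫⁻ ω, ENNReal.ofReal (s' ^ Y' ω) ∂P ≤ ∫⁻ ω, ENNReal.ofReal (s ^ Y' ω) ∂P :=
        lintegral_mono fun ω => ENNReal.ofReal_le_ofReal (pow_le_pow_left₀ h0 hs _)
    _ ≤ _ := lintegral_comp_le_of_stochLE hY hY' h
        (fun a b hab => pow_le_pow_of_le_one (h0.trans hs) h1 hab)
        fun k => pow_nonneg (h0.trans hs) k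

end Pgf

/-! ### Reaches in the frog model -/

section Model

variable {Ω : Type*} [MeasurableSpace Ω] {P : Measure Ω} {p : ℕ → ℝ}
  {X : ℕ → Ω → ℕ} {ξ : ℕ → ℕ → ℕ → Ω → ℤ}

/-- The event that some frog from site `j` would move at least `k` sites to the right of `j`. -/
def reachEvent {Ω : Type*} (X : ℕ → Ω → ℕ) (ξ : ℕ → ℕ → ℕ → Ω → ℤ) (j k : ℕ) : Set Ω :=
  {ω | Reaches (fun j => X j ω) (fun j i n => ξ j i n ω) j k}

/-- The number of frogs at site `j`, together with all the steps of these frogs. -/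
def siteData {Ω : Type*} (X : ℕ → Ω → ℕ) (ξ : ℕ → ℕ → ℕ → Ω → ℤ) (j : ℕ) (ω : Ω) : ℕ × (ℕ × ℕ → ℤ) :=
  (X j ω, fun q => ξ j q.1 q.2 ω)

/-- Measurability with respect to the data of site `j` alone is what transfers the independence of
sites to the reaches. -/
lemma measurableSet_reachEvent {Ω : Type*} {X : ℕ → Ω → ℕ} {ξ : ℕ → ℕ → ℕ → Ω → ℤ} (j k : ℕ) :
    MeasurableSet[MeasurableSpace.comap (siteData X ξ j) inferInstance] (reachEvent X ξ j k) := by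
  refine ⟨⋃ i : ℕ, ⋃ m : ℕ, {y | i < y.1 ∧ (k : ℤ) ≤ ∑ n ∈ range m, y.2 (i, n)}, ?_, ?_⟩
  · refine MeasurableSet.iUnion fun i => MeasurableSet.iUnion fun m => MeasurableSet.inter ?_ ?_
    · exact measurable_fst (measurableSet_Ioi (a := i))
    · exact measurableSet_le measurable_const
        (Finset.measurable_sum _ fun n _ =>
          (measurable_pi_apply (X := fun _ : ℕ × ℕ => ℤ) (i, n)).comp measurable_snd)
  · ext ω
    simp [reachEvent, siteData, Reaches]

lemma antitone_reachEvent {Ω : Type*} {X : ℕ → Ω → ℕ} {ξ : ℕ → ℕ → ℕ → Ω → ℤ} (j : ℕ) : Antitone (reachEvent X ξ j) :=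
  fun _ _ hkl ω hω => Reaches.mono (x := fun j => X j ω) (ξ := fun j i n => ξ j i n ω) hkl hω

namespace IsNonhomogeneous

variable (h : IsNonhomogeneous P p X ξ)
include h

lemma isWalk (j i : ℕ) : IsWalk P (p j) (ξ j i) where
  measurable_step := h.measurable_step j i
  indep := h.indep_step.precomp (g := fun n => (j, i, n)) fun a b hab => by simpa using hab
  half_lt := (h.drift j).1
  lt_one := (h.drift j).2
  step_left := h.step_left j i
  step_right := h.step_right j i

lemma measurable_siteData (j : ℕ) : Measurable (siteData X ξ j) :=
  (h.measurable_count j).prodMk (measurable_pi_iff.2 fun q => h.measurable_step j q.1 q.2)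

lemma iIndepFun_siteData : iIndepFun (siteData X ξ) P := by
  refine iIndepFun_prodMk (g := fun j ω (q : ℕ × ℕ) => ξ j q.1 q.2 ω) h.measurable_count
    (fun j => measurable_pi_iff.2 fun q => h.measurable_step j q.1 q.2) h.indep_count
    (iIndepFun_rows (f := fun j (q : ℕ × ℕ) => ξ j q.1 q.2)
      (fun j q => h.measurable_step j q.1 q.2) h.indep_step) ?_
  exact h.indep_count_step.comp (φ := id)
    (ψ := fun (v : ℕ → ℕ → ℕ → ℤ) j (q : ℕ × ℕ) => v j q.1 q.2) measurable_id
    (measurable_pi_iff.2 fun j => measurable_pi_iff.2 fun q => by fun_prop)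

lemma measurableSet_reachEvent_ambient (j k : ℕ) : MeasurableSet (reachEvent X ξ j k) :=
  (h.measurable_siteData j).comap_le _ (measurableSet_reachEvent j k)

lemma ratio_pos (j : ℕ) : 0 < (1 - p j) / p j :=
  div_pos (by linarith [(h.drift j).2]) (by linarith [(h.drift j).1])

lemma ratio_lt_one (j : ℕ) : (1 - p j) / p j < 1 := by
  rw [div_lt_one (by linarith [(h.drift j).1])]
  linarith [(h.drift j).1]

lemma ratio_mono {j : ℕ} (hj : 1 ≤ j) : (1 - p j) / p j ≤ (1 - p (j + 1)) / p (j + 1) := by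
  have := h.drift_decreasing j hj
  rw [div_le_div_iff₀ (by linarith [(h.drift j).1]) (by linarith [(h.drift (j + 1)).1])]
  nlinarith

/-- The event that the frog `(j, i)` would not move `k` sites to the right has probability
`1 - ((1 - p j) / p j) ^ k`, independently of the other frogs at `j` and of their number. -/
lemma measure_count_inter_not_reach (j k x : ℕ) :
    P ({ω | X j ω = x} ∩ (reachEvent X ξ j k)ᶜ)
      = ENNReal.ofReal (P.real {ω | X j ω = x} * (1 - ((1 - p j) / p j) ^ k) ^ x) := by
  have : IsProbabilityMeasure P := h.indep_count.isProbabilityMeasure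
  set N : Set (ℕ → ℤ) := {v | ∀ m, ∑ n ∈ range m, v n < k} with hN
  have hNm : MeasurableSet N := by
    rw [hN, Set.ofPred_forall]
    exact MeasurableSet.iInter fun m => measurableSet_lt
      (Finset.measurable_sum _ fun n _ => measurable_pi_apply n) measurable_const
  have hfrog : ∀ i, P ((fun ω n => ξ j i n ω) ⁻¹' N)
      = ENNReal.ofReal (1 - ((1 - p j) / p j) ^ k) := by
    intro i
    have hm : Measurable fun ω n => ξ j i n ω := measurable_pi_iff.2 (h.measurable_step j i)
    have h1 := (h.isWalk j i).measure_reach k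
    have h2 : {ω | ∃ m, (k : ℤ) ≤ ∑ n ∈ range m, ξ j i n ω} = ((fun ω n => ξ j i n ω) ⁻¹' N)ᶜ := by
      ext ω
      simp [hN]
    rw [h2, probReal_compl_eq_one_sub (hm hNm)] at h1
    rw [← ofReal_measureReal, ← h1, sub_sub_cancel]
  have hrows : iIndepFun (fun i ω n => ξ j i n ω) P :=
    iIndepFun_rows (h.measurable_step j)
      (h.indep_step.precomp (g := fun q : ℕ × ℕ => (j, q.1, q.2)) fun a b hab => by
        simpa [Prod.ext_iff] using hab)
  have hcount : IndepFun (X j) (fun ω i n => ξ j i n ω) P :=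
    h.indep_count_step.comp (measurable_pi_apply j) (measurable_pi_apply j)
  have hset : {ω | X j ω = x} ∩ (reachEvent X ξ j k)ᶜ = X j ⁻¹' {x} ∩
      (fun ω i n => ξ j i n ω) ⁻¹' ⋂ i ∈ range x, Function.eval i ⁻¹' N := by
    ext ω
    simp only [Set.mem_inter_iff, Set.mem_ofPred_eq, Set.mem_compl_iff, Set.mem_preimage,
      Set.mem_singleton_iff]
    refine and_congr_right fun hx => ?_
    simp [reachEvent, Reaches, hx, hN]
  rw [hset, hcount.measure_inter_preimage_eq_mul _ _ (measurableSet_singleton x)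
    (Finset.measurableSet_biInter _ fun i _ => measurable_pi_apply i hNm)]
  simp only [Set.preimage_iInter]
  have h1 := hrows.measure_inter_preimage_eq_mul (range x) (sets := fun _ => N) fun _ _ => hNm
  rw [ENNReal.ofReal_mul measureReal_nonneg, ofReal_measureReal]
  refine congrArg₂ _ rfl (h1.trans ?_)
  have h0 : 0 ≤ 1 - ((1 - p j) / p j) ^ k :=
    sub_nonneg.2 (pow_le_one₀ (h.ratio_pos j).le (h.ratio_lt_one j).le)
  rw [prod_congr rfl fun i _ => hfrog i, prod_const, card_range, ENNReal.ofReal_pow h0]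

lemma failure_mem (j k : ℕ) : 0 ≤ 1 - ((1 - p j) / p j) ^ k ∧ 1 - ((1 - p j) / p j) ^ k ≤ 1 :=
  ⟨sub_nonneg.2 (pow_le_one₀ (h.ratio_pos j).le (h.ratio_lt_one j).le),
    sub_le_self _ (pow_nonneg (h.ratio_pos j).le k)⟩

lemma measure_compl_reachEvent (j k : ℕ) :
    P.real (reachEvent X ξ j k)ᶜ = pgf P (X j) (1 - ((1 - p j) / p j) ^ k) := by
  have : IsProbabilityMeasure P := h.indep_count.isProbabilityMeasure
  have hU : (reachEvent X ξ j k)ᶜ = ⋃ x, {ω | X j ω = x} ∩ (reachEvent X ξ j k)ᶜ := by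
    ext ω
    simp
  have hm : P (reachEvent X ξ j k)ᶜ = ∑' x, P ({ω | X j ω = x} ∩ (reachEvent X ξ j k)ᶜ) := by
    conv_lhs => rw [hU]
    refine measure_iUnion ?_ fun x => ((h.measurable_count j) (measurableSet_singleton x)).inter
      (h.measurableSet_reachEvent_ambient j k).compl
    intro a b hab
    exact Set.disjoint_left.2 fun ω ha hb => hab (ha.1.symm.trans hb.1)
  rw [measureReal_def, hm, ENNReal.tsum_toReal_eq fun x => measure_ne_top _ _, pgf]
  refine tsum_congr fun x => ?_
  rw [h.measure_count_inter_not_reach, ENNReal.toReal_ofReal]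
  exact mul_nonneg measureReal_nonneg (pow_nonneg (h.failure_mem j k).1 x)

/-- More frogs and a weaker left drift both help to reach `k`. The comparison starts at site `1`,
since neither monotonicity hypothesis covers the origin. -/
lemma measure_compl_reachEvent_mono (j k : ℕ) :
    P.real (reachEvent X ξ (j + 2) k)ᶜ ≤ P.real (reachEvent X ξ (j + 1) k)ᶜ := by
  have : IsProbabilityMeasure P := h.indep_count.isProbabilityMeasure
  rw [h.measure_compl_reachEvent, h.measure_compl_reachEvent]
  exact pgf_le_pgf (h.measurable_count _) (h.measurable_count _)
    (h.count_increasing (j + 1) (by omega)) (h.failure_mem _ k).1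
    (sub_le_sub_left (pow_le_pow_left₀ (h.ratio_pos _).le (h.ratio_mono (by omega)) k) 1)
    (h.failure_mem _ k).2

lemma ae_step : ∀ᵐ ω ∂P, ∀ j i n, ξ j i n ω = -1 ∨ ξ j i n ω = 1 :=
  ae_all_iff.2 fun j => ae_all_iff.2 fun i => ae_all_iff.2 fun n => (h.isWalk j i).step_eq n

lemma ae_tendsto_atBot :
    ∀ᵐ ω ∂P, ∀ j i, Tendsto (fun m => ∑ n ∈ range m, ξ j i n ω) atTop atBot :=
  ae_all_iff.2 fun j => ae_all_iff.2 fun i => (h.isWalk j i).tendsto_atBot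

lemma ae_exists_notMem_reachEvent (j : ℕ) : ∀ᵐ ω ∂P, ∃ k, ω ∉ reachEvent X ξ j k := by
  filter_upwards [h.ae_tendsto_atBot] with ω hω
  have hbdd : ∀ i, ∃ K : ℕ, ∀ m, ∑ n ∈ range m, ξ j i n ω < K := by
    intro i
    obtain ⟨z, hz⟩ := bddAbove_range_of_tendsto_atTop_atBot (hω j i)
    refine ⟨z.toNat + 1, fun m => ?_⟩
    have := hz (Set.mem_range_self m)
    push_cast
    omega
  choose K hK using hbdd
  refine ⟨(range (X j ω)).sup K, ?_⟩
  rintro ⟨i, hi, m, hm⟩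
  have h1 : K i ≤ (range (X j ω)).sup K := le_sup (mem_range.2 hi)
  have h2 := hK i m
  have h3 : (K i : ℤ) ≤ ((range (X j ω)).sup K : ℕ) := by exact_mod_cast h1
  simp only at hm
  omega

lemma measure_reachEvent_zero_ne_zero (k : ℕ) : P (reachEvent X ξ 0 k) ≠ 0 := by
  have : IsProbabilityMeasure P := h.indep_count.isProbabilityMeasure
  intro h0
  have h1 : 0 < ((1 - p 0) / p 0) ^ k := pow_pos (h.ratio_pos 0) k
  rw [← (h.isWalk 0 0).measure_reach k, measureReal_def] at h1
  refine h1.ne' ?_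
  rw [ENNReal.toReal_eq_zero_iff]
  refine Or.inl (measure_mono_null ?_ h0)
  rintro ω ⟨m, hm⟩
  exact ⟨0, by simp [h.count_origin ω], m, hm⟩

/-- Second Borel–Cantelli: the probabilities of being occupied are bounded below by that of site
`1`. -/
lemma ae_frequently_count_ne_zero : ∀ᵐ ω ∂P, ∃ᶠ j in atTop, X j ω ≠ 0 := by
  have : IsProbabilityMeasure P := h.indep_count.isProbabilityMeasure
  have hm : ∀ j, MeasurableSet {ω | X j ω ≠ 0} := fun j =>
    h.measurable_count j (measurableSet_singleton 0).compl
  have hind : iIndepSet (fun j => {ω | X j ω ≠ 0}) P := by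
    rw [iIndepSet_iff_meas_biInter hm]
    intro S
    exact h.indep_count.measure_inter_preimage_eq_mul S (sets := fun _ => {0}ᶜ)
      fun _ _ => (measurableSet_singleton 0).compl
  have hge : ∀ j, P {ω | X 1 ω ≠ 0} ≤ P {ω | X (j + 1) ω ≠ 0} := by
    intro j
    induction j with
    | zero => exact le_rfl
    | succ j ih =>
      have := h.count_increasing (j + 1) (by omega) 1
      simp only [Nat.one_le_iff_ne_zero] at this
      exact ih.trans this
  have hsum : ∑' j, P {ω | X j ω ≠ 0} = ∞ := by
    refine top_unique (le_trans ?_ (ENNReal.tsum_comp_le_tsum_of_injective (f := fun j => j + 1)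
      (add_left_injective 1) fun j => P {ω | X j ω ≠ 0}))
    refine le_trans (le_of_eq ?_) (ENNReal.tsum_le_tsum hge)
    exact (ENNReal.tsum_const_eq_top_of_ne_zero (h.count_nonzero 1 le_rfl).ne').symm
  have := measure_limsup_eq_one hm hind hsum
  have hae := (mem_ae_iff_prob_eq_one (MeasurableSet.measurableSet_limsup hm)).2 this
  filter_upwards [hae] with ω hω
  exact mem_limsup_iff_frequently_mem.1 hω

/-- The model is transient iff almost surely some site is not reached from its left. -/
lemma transient_iff_ae_exists_noneReach :
    Transient P X ξ ↔ ∀ᵐ ω ∂P, ∃ n, 1 ≤ n ∧ ω ∈ noneReach (reachEvent X ξ) n := by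
  constructor
  · intro ht
    filter_upwards [ht, h.ae_step, h.ae_tendsto_atBot, h.ae_frequently_count_ne_zero]
      with ω hω h1 h2 h3
    by_contra hcon
    refine infinite_hitsOrigin h1 h2 h3 (fun n hn => ?_) hω
    by_contra hcon'
    push Not at hcon'
    exact hcon ⟨n, hn, mem_noneReach.2 hcon'⟩
  · intro hae
    filter_upwards [hae] with ω hω
    obtain ⟨n, hn, hω⟩ := hω
    exact finite_hitsOrigin hn (mem_noneReach.1 hω)

end IsNonhomogeneous

end Model

end FrogModel

theorem theorem1p1 {Ω : Type*} [MeasurableSpace Ω] (P : MeasureTheory.Measure Ω)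
    [MeasureTheory.IsProbabilityMeasure P] (p : ℕ → ℝ) (X : ℕ → Ω → ℕ) (ξ : ℕ → ℕ → ℕ → Ω → ℤ)
    (h : FrogModel.IsNonhomogeneous P p X ξ) :
    FrogModel.Transient P X ξ ↔
      ∑' n : {n : ℕ // 2 ≤ n}, ENNReal.ofReal
        (∏ j ∈ Finset.Ico 1 n.1,
          FrogModel.pgf P (X j) (1 - ((1 - p j) / p j) ^ (n.1 - j))) = ⊤ := by
  rw [h.transient_iff_ae_exists_noneReach,
    FrogModel.ae_exists_noneReach_iff (fun j => (h.measurable_siteData j).comap_le)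
      ((iIndepFun_iff_iIndep _ _ _).1 h.iIndepFun_siteData) FrogModel.measurableSet_reachEvent
      FrogModel.antitone_reachEvent (fun j k _ => h.measure_compl_reachEvent_mono j k)
      h.ae_exists_notMem_reachEvent h.measure_reachEvent_zero_ne_zero]
  set a : ℕ → ℝ := fun n =>
    P.real (FrogModel.noneReach (fun j => FrogModel.reachEvent X ξ (j + 1)) n) with ha
  have ha0 : ∀ n, 0 ≤ a n := fun n => measureReal_nonneg
  let e : ℕ ≃ {n : ℕ // 2 ≤ n} :=
    { toFun := fun n => ⟨n + 2, by omega⟩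
      invFun := fun n => n.1 - 2
      left_inv := fun n => by simp
      right_inv := fun n => Subtype.ext (by have := n.2; simp only; omega) }
  have hterm : ∀ n : ℕ, (∏ j ∈ Finset.Ico 1 (n + 2),
      FrogModel.pgf P (X j) (1 - ((1 - p j) / p j) ^ (n + 2 - j))) = a (n + 1) := by
    intro n
    simp only [ha]
    rw [FrogModel.measure_noneReach (m := fun j => MeasurableSpace.comap
        (FrogModel.siteData X ξ (j + 1)) inferInstance)
      (((iIndepFun_iff_iIndep _ _ _).1 h.iIndepFun_siteData).precomp (add_left_injective 1))
      (fun j k => FrogModel.measurableSet_reachEvent (j + 1) k),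
      Finset.prod_Ico_eq_prod_range]
    refine Finset.prod_congr (by simp) fun j _ => ?_
    rw [h.measure_compl_reachEvent, add_comm 1 j, show n + 2 - (j + 1) = n + 1 - j by omega]
  rw [← e.tsum_eq]
  simp only [e, Equiv.coe_fn_mk, hterm]
  -- The series starts at `a 1`; the extra term `a 0`, an empty product, does not affect
  -- summability.
  rw [← summable_nat_add_iff 1]
  constructor
  · intro hs
    by_contra hcon
    refine hs ?_
    have := ENNReal.summable_toReal hcon
    simpa [ENNReal.toReal_ofReal (ha0 _)] using this
  · intro htop hs
    exact hs.tsum_ofReal_ne_top htop
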